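/- Let $m>1$ be an integer and let $B(m,-m)=\langle a,b : a^{-1}b^{m}a=b^{-m}\rangle$ be the Baumslag–Solitar group. For an endomorphism $\phi$ of a group $G$, call $\alpha,\alpha'\in G$ $\phi$-conjugate if $\alpha'=\gamma\alpha\phi(\gamma)^{-1}$ for some $\gamma\in G$; the Reidemeister number $R(\phi)$ is the number of $\phi$-conjugacy classes in $G$. Then $R(\phi)=\infty$ for every automorphism $\phi$ of $B(m,-m)$. -/

import Mathlib

/-- Two elements `x`, `y` of `G` are `φ`-conjugate if `y = g * x * (φ g)⁻¹` for some `g`. -/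
def IsTwistedConj {G : Type*} [Group G] (φ : G →* G) (x y : G) : Prop :=
  ∃ g : G, y = g * x * (φ g)⁻¹

theorem isTwistedConj_equivalence {G : Type*} [Group G] (φ : G →* G) :
    Equivalence (IsTwistedConj φ) where
  refl x := ⟨1, by simp⟩
  symm := by
    rintro x y ⟨g, rfl⟩
    exact ⟨g⁻¹, by simp [mul_assoc]⟩
  trans := by
    rintro x y z ⟨g, rfl⟩ ⟨h, rfl⟩
    exact ⟨h * g, by simp [mul_assoc]⟩

/-- `φ`-conjugacy as an equivalence relation on `G`. -/
def twistedConjSetoid {G : Type*} [Group G] (φ : G →* G) : Setoid G where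
  r := IsTwistedConj φ
  iseqv := isTwistedConj_equivalence φ

/-- The Reidemeister number `R(φ)` of an endomorphism `φ`: the number of `φ`-conjugacy classes,
with value `⊤` when there are infinitely many. -/
noncomputable def reidemeisterNumber {G : Type*} [Group G] (φ : G →* G) : ℕ∞ :=
  ENat.card (Quotient (twistedConjSetoid φ))

/-- The relator of the presentation `⟨a, b : a⁻¹ b ^ m a = b ^ n⟩`, where the generators
`a`, `b` are indexed by `0`, `1`. -/
def baumslagSolitarRelator (m n : ℤ) : FreeGroup (Fin 2) :=
  (FreeGroup.of 0)⁻¹ * FreeGroup.of 1 ^ m * FreeGroup.of 0 * (FreeGroup.of 1 ^ n)⁻¹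

/-- The Baumslag-Solitar group `B(m,n) = ⟨a, b : a⁻¹ b ^ m a = b ^ n⟩`. -/
abbrev BaumslagSolitar (m n : ℤ) : Type :=
  PresentedGroup {baumslagSolitarRelator m n}

/-!
Sending `a` to a reflection and `b` to a generating rotation maps `B(m,-m)` onto the infinite
dihedral group `D∞`, and this quotient is preserved by every surjective endomorphism `φ`: since `b`
has finite order in the abelianization, `φ b` has exponent sum `0` in `a` and so is mapped to a
rotation, and then surjectivity forces `φ a` to be mapped to a reflection. It therefore suffices to
treat a surjective endomorphism of `D∞` of the form `r 1 ↦ r y`, `sr 0 ↦ sr k`. Here `y = ±1`, and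
after composing with conjugation by a reflection, which does not change the Reidemeister number,
`y = 1`. An endomorphism that fixes an infinite commutative subgroup `N` of finite index pointwise
has infinitely many twisted conjugacy classes, because each class of an element of `N` is finite:
it has at most as many elements as there are cosets of `N`.
-/

section ReidemeisterNumber

variable {G H : Type*} [Group G] [Group H]

theorem reidemeisterNumber_le_of_semiconj {φ : G →* G} {ψ : H →* H} {p : G →* H}
    (hp : Function.Surjective p) (h : p.comp φ = ψ.comp p) :
    reidemeisterNumber ψ ≤ reidemeisterNumber φ := by
  have hφ (g : G) : p (φ g) = ψ (p g) := DFunLike.congr_fun h g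
  have hmap ⦃x y : G⦄ : IsTwistedConj φ x y → IsTwistedConj ψ (p x) (p y) := by
    rintro ⟨g, rfl⟩
    exact ⟨p g, by simp only [map_mul, map_inv, hφ]⟩
  have hsurj := Quotient.map_surjective (sa := twistedConjSetoid φ) (sb := twistedConjSetoid ψ)
    hmap hp
  exact ENat.card_le_card_of_injective (Function.injective_surjInv hsurj)

theorem reidemeisterNumber_conj_comp (h : G) (φ : G →* G) :
    reidemeisterNumber ((MulAut.conj h).toMonoidHom.comp φ) = reidemeisterNumber φ := by
  refine ENat.card_congr (Quotient.congr (Equiv.mulRight h) fun x y => exists_congr fun g => ?_)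
  simp [← eq_mul_inv_iff_mul_eq, mul_assoc]

theorem finite_setOf_isTwistedConj_of_fixes (φ : G →* G) (N : Subgroup G) [N.FiniteIndex]
    (hφ : ∀ n ∈ N, φ n = n) {x : G} (hx : ∀ n ∈ N, n * x = x * n) :
    {y | IsTwistedConj φ x y}.Finite := by
  -- Since `n * x * (φ n)⁻¹ = x` for `n ∈ N`, the element `g * x * (φ g)⁻¹` depends only on `g N`.
  let twist : G ⧸ N → G := Quotient.lift (fun g => g * x * (φ g)⁻¹) fun g g' hg => by
    have hn : g⁻¹ * g' ∈ N := QuotientGroup.leftRel_apply.mp hg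
    obtain ⟨n, rfl⟩ : ∃ n, g' = g * n := ⟨g⁻¹ * g', by group⟩
    rw [inv_mul_cancel_left] at hn
    simp only [map_mul, hφ n hn]
    calc g * x * (φ g)⁻¹ = g * (x * n) * n⁻¹ * (φ g)⁻¹ := by group
      _ = g * n * x * (φ g * n)⁻¹ := by rw [← hx n hn]; group
  refine (Set.finite_range twist).subset ?_
  rintro _ ⟨g, rfl⟩
  exact ⟨(g : G ⧸ N), rfl⟩

theorem reidemeisterNumber_eq_top_of_fixes (φ : G →* G) (N : Subgroup G) [N.FiniteIndex]
    [Infinite N] [IsMulCommutative N] (hφ : ∀ n ∈ N, φ n = n) : reidemeisterNumber φ = ⊤ := by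
  rw [reidemeisterNumber, ENat.card_eq_top]
  by_contra hfin
  rw [not_infinite_iff_finite] at hfin
  refine Set.infinite_coe_iff.mp ‹Infinite N› (Set.Finite.of_finite_fibers
    (Quotient.mk (twistedConjSetoid φ)) (Set.toFinite _) ?_)
  rintro _ ⟨x, hx, rfl⟩
  have hcomm (n : G) (hn : n ∈ N) : n * x = x * n := setLike_mul_comm hn hx
  refine (finite_setOf_isTwistedConj_of_fixes φ N hφ hcomm).subset ?_
  rintro y ⟨-, hy⟩
  exact Quotient.exact hy.symm

end ReidemeisterNumber

section Dihedral

open DihedralGroup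

variable {n : ℕ}

/-- The sign character of a dihedral group: `1` on rotations and `-1` on reflections. -/
def dihedralSign (n : ℕ) : DihedralGroup n →* ℤˣ where
  toFun
    | r _ => 1
    | sr _ => -1
  map_one' := rfl
  map_mul' := by rintro (i | i) (j | j) <;> simp

@[simp] theorem dihedralSign_r (i : ZMod n) : dihedralSign n (r i) = 1 := rfl

@[simp] theorem dihedralSign_sr (i : ZMod n) : dihedralSign n (sr i) = -1 := rfl

theorem exists_eq_r_of_dihedralSign_eq_one {x : DihedralGroup n} (hx : dihedralSign n x = 1) :
    ∃ i, x = r i := by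
  rcases x with i | i
  · exact ⟨i, rfl⟩
  · simp at hx

theorem exists_eq_sr_of_dihedralSign_ne_one {x : DihedralGroup n} (hx : dihedralSign n x ≠ 1) :
    ∃ i, x = sr i := by
  rcases x with i | i
  · simp at hx
  · exact ⟨i, rfl⟩

/-- The endomorphism of a dihedral group given by `r 1 ↦ r y` and `sr 0 ↦ sr k`. -/
def dihedralEnd (y k : ZMod n) : DihedralGroup n →* DihedralGroup n where
  toFun
    | r i => r (y * i)
    | sr i => sr (k + y * i)
  map_one' := congrArg r (mul_zero y)
  map_mul' := by rintro (i | i) (j | j) <;>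
    simp only [r_mul_r, r_mul_sr, sr_mul_r, sr_mul_sr, r.injEq, sr.injEq] <;> ring

@[simp] theorem dihedralEnd_r (y k i : ZMod n) : dihedralEnd y k (r i) = r (y * i) := rfl

@[simp] theorem dihedralEnd_sr (y k i : ZMod n) : dihedralEnd y k (sr i) = sr (k + y * i) := rfl

theorem isUnit_of_dihedralEnd_surjective {y k : ZMod n}
    (h : Function.Surjective (dihedralEnd y k)) : IsUnit y := by
  obtain ⟨i | i, hi⟩ := h (r 1)
  · exact IsUnit.of_mul_eq_one i (r.inj hi)
  · cases hi

instance isMulCommutative_ker_dihedralSign : IsMulCommutative (dihedralSign n).ker where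
  is_comm.comm := by
    rintro ⟨x, hx⟩ ⟨y, hy⟩
    obtain ⟨i, rfl⟩ := exists_eq_r_of_dihedralSign_eq_one hx
    obtain ⟨j, rfl⟩ := exists_eq_r_of_dihedralSign_eq_one hy
    simp [add_comm]

instance infinite_ker_dihedralSign : Infinite (dihedralSign 0).ker :=
  Infinite.of_injective (fun i : ℤ => ⟨r i, dihedralSign_r _⟩) fun _ _ h =>
    r.inj (congrArg Subtype.val h)

theorem reidemeisterNumber_eq_top_of_fixes_rotations
    (ψ : DihedralGroup 0 →* DihedralGroup 0) (hψ : ∀ i, ψ (r i) = r i) :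
    reidemeisterNumber ψ = ⊤ := by
  refine reidemeisterNumber_eq_top_of_fixes ψ (dihedralSign 0).ker fun x hx => ?_
  obtain ⟨i, rfl⟩ := exists_eq_r_of_dihedralSign_eq_one hx
  exact hψ i

theorem reidemeisterNumber_dihedralEnd {y : ZMod 0} (hy : IsUnit y) (k : ZMod 0) :
    reidemeisterNumber (dihedralEnd y k) = ⊤ := by
  obtain rfl | rfl : y = 1 ∨ y = -1 := Int.isUnit_iff.mp hy
  · exact reidemeisterNumber_eq_top_of_fixes_rotations _ fun i => by simp
  · rw [← reidemeisterNumber_conj_comp (sr 0)]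
    exact reidemeisterNumber_eq_top_of_fixes_rotations _ fun i => by simp

end Dihedral

namespace BaumslagSolitar

variable {m n : ℤ} {G : Type*} [Group G]

/-- The stable letter `a` of `B(m,n)`. -/
abbrev a (m n : ℤ) : BaumslagSolitar m n := PresentedGroup.of 0

/-- The base generator `b` of `B(m,n)`. -/
abbrev b (m n : ℤ) : BaumslagSolitar m n := PresentedGroup.of 1

theorem relation (m n : ℤ) : (a m n)⁻¹ * b m n ^ m * a m n = b m n ^ n :=
  mul_inv_eq_one.mp (PresentedGroup.one_of_mem (Set.mem_singleton (baumslagSolitarRelator m n)))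

theorem hom_ext {f g : BaumslagSolitar m n →* G} (ha : f (a m n) = g (a m n))
    (hb : f (b m n) = g (b m n)) : f = g :=
  PresentedGroup.ext (Fin.forall_fin_two.mpr ⟨ha, hb⟩)

/-- The universal property of `B(m,n)`: the homomorphism with `a ↦ u` and `b ↦ v`. -/
def lift (u v : G) (h : u⁻¹ * v ^ m * u = v ^ n) : BaumslagSolitar m n →* G :=
  PresentedGroup.toGroup (f := ![u, v]) (by
    rintro _ rfl
    simpa [baumslagSolitarRelator, mul_inv_eq_one] using h)

@[simp] theorem lift_a (u v : G) (h : u⁻¹ * v ^ m * u = v ^ n) : lift u v h (a m n) = u :=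
  PresentedGroup.toGroup.of _

@[simp] theorem lift_b (u v : G) (h : u⁻¹ * v ^ m * u = v ^ n) : lift u v h (b m n) = v :=
  PresentedGroup.toGroup.of _

theorem map_b_eq_one {A : Type*} [CommGroup A] [IsMulTorsionFree A] (hmn : m ≠ n)
    (f : BaumslagSolitar m n →* A) : f (b m n) = 1 := by
  have h : f (b m n) ^ m = f (b m n) ^ n := by
    simpa only [map_mul, map_inv, map_zpow, inv_mul_cancel_comm] using congrArg f (relation m n)
  exact (IsMulTorsionFree.zpow_eq_one_iff_left (sub_ne_zero.mpr hmn)).mp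
    (by rw [zpow_sub, h, mul_inv_cancel])

/-- The exponent sum of the stable letter `a`, written multiplicatively. -/
def exponentSum (m n : ℤ) : BaumslagSolitar m n →* Multiplicative ℤ :=
  lift (Multiplicative.ofAdd 1) 1 (by simp)

/-- The quotient map of `B(m,-m)` onto the infinite dihedral group. -/
def toDihedral (m : ℤ) : BaumslagSolitar m (-m) →* DihedralGroup 0 :=
  lift (DihedralGroup.sr 0) (DihedralGroup.r 1) (by simp)

theorem toDihedral_surjective (m : ℤ) : Function.Surjective (toDihedral m) := by
  rintro (i | i) <;> obtain ⟨j, rfl⟩ := ZMod.intCast_surjective i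
  · exact ⟨b m (-m) ^ j, by simp [toDihedral]⟩
  · exact ⟨a m (-m) * b m (-m) ^ j, by simp [toDihedral]⟩

theorem dihedralSign_comp_toDihedral (m : ℤ) :
    (dihedralSign 0).comp (toDihedral m) = (zpowersHom ℤˣ (-1)).comp (exponentSum m (-m)) :=
  hom_ext (by simp [toDihedral, exponentSum]) (by simp [toDihedral, exponentSum])

theorem dihedralSign_toDihedral_map_b {k : ℤ} (hmn : m ≠ n)
    (φ : BaumslagSolitar m n →* BaumslagSolitar k (-k)) :
    dihedralSign 0 (toDihedral k (φ (b m n))) = 1 := by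
  have hexp : exponentSum k (-k) (φ (b m n)) = 1 :=
    map_b_eq_one hmn ((exponentSum k (-k)).comp φ)
  simpa [hexp] using DFunLike.congr_fun (dihedralSign_comp_toDihedral k) (φ (b m n))

theorem dihedralSign_map_a_ne_one {k : ℕ} {f : BaumslagSolitar m n →* DihedralGroup k}
    (hf : Function.Surjective f) (hb : dihedralSign k (f (b m n)) = 1) :
    dihedralSign k (f (a m n)) ≠ 1 := by
  intro ha
  have htriv : (dihedralSign k).comp f = 1 := hom_ext ha hb
  obtain ⟨g, hg⟩ := hf (DihedralGroup.sr 0)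
  simpa [hg] using DFunLike.congr_fun htriv g

theorem exists_toDihedral_comp_eq (hm : m ≠ 0)
    {φ : BaumslagSolitar m (-m) →* BaumslagSolitar m (-m)} (hφ : Function.Surjective φ) :
    ∃ y k, IsUnit y ∧ (toDihedral m).comp φ = (dihedralEnd y k).comp (toDihedral m) := by
  have hsurj : Function.Surjective ((toDihedral m).comp φ) := (toDihedral_surjective m).comp hφ
  have hb := dihedralSign_toDihedral_map_b (self_ne_neg.mpr hm) φ
  obtain ⟨y, hy⟩ := exists_eq_r_of_dihedralSign_eq_one hb
  obtain ⟨k, hk⟩ := exists_eq_sr_of_dihedralSign_ne_one (dihedralSign_map_a_ne_one hsurj hb)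
  have hcomp : (toDihedral m).comp φ = (dihedralEnd y k).comp (toDihedral m) :=
    hom_ext (hk.trans (by simp [toDihedral])) (hy.trans (by simp [toDihedral]))
  refine ⟨y, k, isUnit_of_dihedralEnd_surjective (k := k) ?_, hcomp⟩
  exact Function.Surjective.of_comp (g := toDihedral m) (by simpa [hcomp] using hsurj)

end BaumslagSolitar

theorem theorem5p4_general (m : ℤ) (hm : m ≠ 0)
    (φ : BaumslagSolitar m (-m) →* BaumslagSolitar m (-m)) (hφ : Function.Surjective φ) :
    reidemeisterNumber φ = ⊤ := by
  obtain ⟨y, k, hy, hcomp⟩ := BaumslagSolitar.exists_toDihedral_comp_eq hm hφ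
  rw [← top_le_iff, ← reidemeisterNumber_dihedralEnd hy k]
  exact reidemeisterNumber_le_of_semiconj (BaumslagSolitar.toDihedral_surjective m) hcomp

theorem theorem5p4 (m : ℤ) (hm : 1 < m)
    (φ : BaumslagSolitar m (-m) ≃* BaumslagSolitar m (-m)) :
    reidemeisterNumber φ.toMonoidHom = ⊤ :=
  theorem5p4_general m (by lia) φ.toMonoidHom φ.surjective
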